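/- Let $\mathbb R_t[\theta]$ be the ring of functions generated over $\mathbb R$ by $\cos\theta$ and $\sin\theta$, let $\mathbb R_t(\theta)$ be its quotient field, and let $\phi:\mathbb R_t[\theta]\to\mathbb C[z,1/z]$ be the injective homomorphism of $\mathbb R$-algebras with $\phi(\cos\theta)=\frac{z+1/z}{2}$ and $\phi(\sin\theta)=\frac{z-1/z}{2i}$; denote its extension $\mathbb R_t(\theta)\to\mathbb C(z)$ also by $\phi$. Let $\mathcal L_{\mathbb R}[z]=\phi(\mathbb R_t[\theta])$, and let $\mathcal L_{\mathbb R}(z)$ be the set of $R\in\mathbb C(z)$ with $\overline R(1/z)=R(z)$, where $\overline R$ is obtained from $R$ by complex conjugation of all coefficients. The degree of a rational function is the maximum of the degrees of its numerator and denominator in lowest terms; $P\circ W=P(W)$; and for $v$ of degree one, $v^{-1}$ is its inverse with respect to composition. (1) Let $L\in\mathcal L_{\mathbb R}[z]$ be non-constant and let $L=P\circ W$ with $P,W\in\mathbb C(z)$. Then there is a rational function $v\in\mathbb C(z)$ of degree one such that $P\circ v^{-1}\in\mathbb R(x)$ and $v\circ W\in\mathcal L_{\mathbb R}(z)$. (2)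 Consequently, let $p\in\mathbb R_t[\theta]$ be non-constant. Call two decompositions $\phi(p)=P\circ W=\widetilde P\circ\widetilde W$ with $P,W,\widetilde P,\widetilde W\in\mathbb C(z)$ equivalent if $\widetilde P=P\circ\mu$ and $\widetilde W=\mu^{-1}\circ W$ for some $\mu\in\mathbb C(z)$ of degree one. Then every decomposition $\phi(p)=P\circ W$ with $P,W\in\mathbb C(z)$ is equivalent to a decomposition $\phi(p)=\widetilde P\circ\widetilde W$ with $\widetilde P\in\mathbb R(x)$ and $\widetilde W=\phi(w)$ for some $w\in\mathbb R_t(\theta)$ such that $p=\widetilde P\circ w$ in $\mathbb R_t(\theta)$. -/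

import Mathlib

namespace TrigDecomp

open LaurentPolynomial

noncomputable section

/-- The ring `ℝ_t[θ]` of real trigonometric polynomials: the ring of functions generated over `ℝ`
by `cos θ` and `sin θ`. -/
def Rt : Subalgebra ℝ (ℝ → ℝ) := Algebra.adjoin ℝ {Real.cos, Real.sin}

/-- `cos θ` as an element of `ℝ_t[θ]`. -/
def cosRt : Rt := ⟨Real.cos, Algebra.subset_adjoin (by simp)⟩

/-- `sin θ` as an element of `ℝ_t[θ]`. -/
def sinRt : Rt := ⟨Real.sin, Algebra.subset_adjoin (by simp)⟩

/-- Evaluation of Laurent polynomials on the unit circle: `L ↦ (θ ↦ L(e^{iθ}))`. -/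
def circleEval : LaurentPolynomial ℂ →ₐ[ℝ] (ℝ → ℂ) :=
  { RingHom.pi (fun θ : ℝ => LaurentPolynomial.eval₂ (RingHom.id ℂ)
      (Units.mk0 (Complex.exp (θ * Complex.I)) (Complex.exp_ne_zero _))) with
    commutes' := fun r => by
      funext θ
      have h : algebraMap ℝ (LaurentPolynomial ℂ) r = LaurentPolynomial.C (r : ℂ) := rfl
      rw [h]
      exact LaurentPolynomial.eval₂_C _ _ _ }

theorem circleEval_apply (L : LaurentPolynomial ℂ) (θ : ℝ) :
    circleEval L θ = LaurentPolynomial.eval₂ (RingHom.id ℂ)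
      (Units.mk0 (Complex.exp (θ * Complex.I)) (Complex.exp_ne_zero _)) L := rfl

theorem circleEval_injective : Function.Injective circleEval := by
  rw [injective_iff_map_eq_zero]
  intro L hL
  obtain ⟨n, f, hf⟩ := LaurentPolynomial.exists_T_pow L
  have hroot : ∀ θ : ℝ, f.eval (Complex.exp (θ * Complex.I)) = 0 := by
    intro θ
    have h1 := congrFun hL θ
    rw [circleEval_apply] at h1
    have h2 := congrArg (LaurentPolynomial.eval₂ (RingHom.id ℂ)
      (Units.mk0 (Complex.exp (θ * Complex.I)) (Complex.exp_ne_zero _))) hf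
    rw [map_mul, h1, LaurentPolynomial.eval₂_toLaurent] at h2
    simpa [Polynomial.eval₂_id] using h2
  have hf0 : f = 0 := by
    apply Polynomial.eq_zero_of_infinite_isRoot
    apply Set.Infinite.mono (s := (fun θ : ℝ => Complex.exp (θ * Complex.I)) '' Set.Ioo 0 1)
    · rintro _ ⟨θ, -, rfl⟩
      exact hroot θ
    · apply Set.Infinite.image _ (Set.Ioo_infinite (by norm_num))
      intro a ha b hb hab
      have h := congrArg Complex.re hab
      simp only [Complex.exp_ofReal_mul_I_re] at h
      have hpi := Real.pi_gt_three
      exact Real.injOn_cos ⟨ha.1.le, by linarith [ha.2]⟩ ⟨hb.1.le, by linarith [hb.2]⟩ h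
  rw [hf0, map_zero] at hf
  exact (LaurentPolynomial.isUnit_T (n : ℤ)).mul_left_eq_zero.mp hf.symm

/-- `(z + 1/z)/2`. -/
def cosL : LaurentPolynomial ℂ := C (1 / 2 : ℂ) * (T 1 + T (-1))

/-- `(z - 1/z)/(2i)`. -/
def sinL : LaurentPolynomial ℂ := C (1 / (2 * Complex.I)) * (T 1 - T (-1))

/-- A real-valued function regarded as a complex-valued one. -/
def ofRealFun : (ℝ → ℝ) →ₐ[ℝ] (ℝ → ℂ) := Complex.ofRealAm.compLeft ℝ

theorem circleEval_cosL : circleEval cosL = ofRealFun Real.cos := by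
  funext θ
  have h : ofRealFun Real.cos θ = ((Real.cos θ : ℝ) : ℂ) := rfl
  rw [h, circleEval_apply, cosL]
  simp only [map_mul, map_add, eval₂_C, eval₂_T, Complex.ofReal_cos, Complex.cos]
  simp [Complex.exp_neg]
  ring

theorem circleEval_sinL : circleEval sinL = ofRealFun Real.sin := by
  funext θ
  have h : ofRealFun Real.sin θ = ((Real.sin θ : ℝ) : ℂ) := rfl
  rw [h, circleEval_apply, sinL]
  simp only [map_mul, map_sub, eval₂_C, eval₂_T, Complex.ofReal_sin, Complex.sin]
  simp [Complex.exp_neg]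
  ring

theorem ofRealFun_mem_range (p : Rt) : ofRealFun (p : ℝ → ℝ) ∈ circleEval.range := by
  have h : Rt ≤ circleEval.range.comap ofRealFun := by
    apply Algebra.adjoin_le
    rintro f (rfl | rfl)
    · exact ⟨cosL, circleEval_cosL⟩
    · exact ⟨sinL, circleEval_sinL⟩
  exact h p.2

/-- The homomorphism `φ : ℝ_t[θ] → ℂ[z, 1/z]` given by `cos θ ↦ (z + 1/z)/2` and
`sin θ ↦ (z - 1/z)/(2i)` (see `phi_cos`, `phi_sin`): `φ p` is the unique Laurent polynomial `L`
with `L(e^{iθ}) = p(θ)` for all real `θ`. -/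
def phi : Rt →ₐ[ℝ] LaurentPolynomial ℂ :=
  ((AlgEquiv.ofInjective circleEval circleEval_injective).symm : _ →ₐ[ℝ] _).comp
    ((ofRealFun.comp Rt.val).codRestrict circleEval.range ofRealFun_mem_range)

theorem circleEval_phi (p : Rt) : circleEval (phi p) = ofRealFun (p : ℝ → ℝ) :=
  congrArg Subtype.val ((AlgEquiv.ofInjective circleEval circleEval_injective).apply_symm_apply
    ⟨ofRealFun (p : ℝ → ℝ), ofRealFun_mem_range p⟩)

theorem phi_cos : phi cosRt = cosL :=
  circleEval_injective ((circleEval_phi _).trans circleEval_cosL.symm)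

theorem phi_sin : phi sinRt = sinL :=
  circleEval_injective ((circleEval_phi _).trans circleEval_sinL.symm)

theorem phi_injective : Function.Injective phi := by
  intro p q h
  have h1 : ofRealFun (p : ℝ → ℝ) = ofRealFun (q : ℝ → ℝ) := by
    rw [← circleEval_phi, ← circleEval_phi, h]
  apply Subtype.ext
  funext θ
  exact Complex.ofReal_injective (congrFun h1 θ)

/-- `𝓛_ℝ[z]`: the image of `ℝ_t[θ]` in `ℂ[z, 1/z]` under `φ`. -/
def LR : Subalgebra ℝ (LaurentPolynomial ℂ) := phi.range

/-- A Laurent polynomial regarded as a rational function, `ℂ[z, 1/z] ⊆ ℂ(z)`. -/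
def toRat : LaurentPolynomial ℂ →+* RatFunc ℂ :=
  LaurentPolynomial.eval₂ RatFunc.C (Units.mk0 RatFunc.X RatFunc.X_ne_zero)

theorem toRat_injective : Function.Injective toRat := by
  rw [injective_iff_map_eq_zero]
  intro L hL
  obtain ⟨n, f, hf⟩ := LaurentPolynomial.exists_T_pow L
  have h2 := congrArg toRat hf
  rw [map_mul, hL, zero_mul, toRat, LaurentPolynomial.eval₂_toLaurent] at h2
  have h4 : algebraMap (Polynomial ℂ) (RatFunc ℂ) =
      Polynomial.eval₂RingHom RatFunc.C RatFunc.X := by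
    apply Polynomial.ringHom_ext <;> simp
  have hf0 : f = 0 := by
    apply RatFunc.algebraMap_injective ℂ
    rw [map_zero, h4]
    exact h2
  rw [hf0, map_zero] at hf
  exact (LaurentPolynomial.isUnit_T (n : ℤ)).mul_left_eq_zero.mp hf.symm

theorem toRat_phi_injective :
    Function.Injective (toRat.comp (phi : Rt →+* LaurentPolynomial ℂ)) :=
  toRat_injective.comp phi_injective

instance : IsDomain Rt := 
  toRat_phi_injective.isDomain (toRat.comp (phi : Rt →+* LaurentPolynomial ℂ))

/-- The quotient field `ℝ_t(θ)` of `ℝ_t[θ]`. -/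
abbrev RtField : Type := FractionRing Rt

/-- The extension of `φ` to the quotient field, `φ : ℝ_t(θ) → ℂ(z)`. -/
def phiField : RtField →+* RatFunc ℂ := IsFractionRing.lift toRat_phi_injective

theorem phiField_algebraMap (p : Rt) : phiField (algebraMap Rt RtField p) = toRat (phi p) :=
  IsFractionRing.lift_algebraMap toRat_phi_injective p

/-- The composition `P ∘ W = P(W)` of rational functions over `ℂ`. (It is used only where `W` is
not a constant, so that `P(W)` is defined.) -/
def comp (P W : RatFunc ℂ) : RatFunc ℂ := RatFunc.eval RatFunc.C W P

/-- The degree of a rational function: the larger of the degrees of the numerator and of the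
denominator in lowest terms. -/
def ratDegree (f : RatFunc ℂ) : ℕ := max f.num.natDegree f.denom.natDegree

/-- `u = v⁻¹` with respect to composition. -/
def IsCompInverse (v u : RatFunc ℂ) : Prop := comp v u = RatFunc.X ∧ comp u v = RatFunc.X

/-- The rational function over the second field obtained by applying a homomorphism of fields to
the coefficients. -/
def mapCoeff {K F : Type} [Field K] [Field F] (σ : K →+* F) : RatFunc K →+* RatFunc F :=
  RatFunc.mapRingHom (Polynomial.mapRingHom σ)
    (nonZeroDivisors_le_comap_nonZeroDivisors_of_injective _
      (Polynomial.map_injective σ σ.injective))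

/-- The inclusion `ℝ(x) ⊆ ℂ(x)`. -/
def ofRealRat : RatFunc ℝ →+* RatFunc ℂ := mapCoeff (algebraMap ℝ ℂ)

/-- `R ↦ R̄`: complex conjugation of the coefficients of a rational function. -/
def conjRat : RatFunc ℂ →+* RatFunc ℂ := mapCoeff (starRingEnd ℂ)

/-- `𝓛_ℝ(z)`: the rational functions `R` with `R̄(1/z) = R(z)`. -/
def LRField : Set (RatFunc ℂ) := {R | comp (conjRat R) (RatFunc.X)⁻¹ = R}

/-- The decompositions `P ∘ W` and `P' ∘ W'` over `ℂ` are equivalent: `P' = P ∘ μ` and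
`W' = μ⁻¹ ∘ W` for some rational function `μ` of degree one. -/
def DecompEquiv (P W P' W' : RatFunc ℂ) : Prop :=
  ∃ μ μ' : RatFunc ℂ, ratDegree μ = 1 ∧ IsCompInverse μ μ' ∧ P' = comp P μ ∧ W' = comp μ' W

end

end TrigDecomp

/-! The map `sigma`, R ↦ R̄(1/z), is a semilinear involution of ℂ(z) with fixed field `LRField`, and
it fixes L. It suffices to find a Möbius v with v∘W fixed: applying `sigma` to L = (P∘v⁻¹)∘(v∘W)
conjugates only the left factor, and composition with a non-constant function is injective, so P∘v⁻¹
is real.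

To find v, note that L has poles only at 0 and ∞. Moving a pole of P to ∞ makes W a Laurent
polynomial w (`exists_mob_toRat`). Two cases remain (`exists_mob_invariant`). If P still has a
finite pole r, then w - r is a unit, so w = r + e z^k, and a Cayley transform of z^k is fixed. If P
is a polynomial N, then N(w) = N̄(w*) with w* = w̄(1/z). Comparing growth at ∞ gives w* + b̄ = ζ(w +
b) + f with |ζ| = 1 and f vanishing at ∞. By symmetry f also vanishes at 0, so f = 0, and a square
root of ζ rescales w + b to a fixed element.

The second claim follows because the fixed field of `sigma` is the image of `phiField`
(`exists_phiField_of_sigma`). -/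

namespace TrigDecomp

open LaurentPolynomial

/-! ### Composition with a non-constant rational function -/

/-- A rational function that is not a constant. -/
def NonConst (W : RatFunc ℂ) : Prop := ∀ c : ℂ, W ≠ RatFunc.C c

/-- Over ℂ, q(W) is a nonzero constant times a product of factors W - a, none of which vanishes. -/
theorem NonConst.eval₂_ne_zero {W : RatFunc ℂ} (hW : NonConst W) {q : Polynomial ℂ} (hq : q ≠ 0) :
    q.eval₂ RatFunc.C W ≠ 0 := by
  rw [(IsAlgClosed.splits q).eq_prod_roots, Polynomial.eval₂_mul, Polynomial.eval₂_C,
    Polynomial.eval₂_multiset_prod]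
  refine mul_ne_zero (by simpa using hq) ?_
  rw [Ne, Multiset.prod_eq_zero_iff]
  simp only [Multiset.mem_map, not_exists, not_and]
  rintro _ ⟨a, -, rfl⟩ h
  simp only [Polynomial.eval₂_sub, Polynomial.eval₂_X, Polynomial.eval₂_C, sub_eq_zero] at h
  exact hW a h

/-- Composition `P ↦ P ∘ W` with a non-constant rational function, as a ring homomorphism. -/
noncomputable def compHom (W : RatFunc ℂ) (hW : NonConst W) : RatFunc ℂ →+* RatFunc ℂ :=
  RatFunc.liftRingHom (Polynomial.eval₂RingHom RatFunc.C W)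
    (nonZeroDivisors_le_comap_nonZeroDivisors_of_injective _
      ((injective_iff_map_eq_zero _).2 fun _ hq => not_imp_not.1 hW.eval₂_ne_zero hq))

theorem comp_eq_compHom {W : RatFunc ℂ} (hW : NonConst W) (P : RatFunc ℂ) :
    comp P W = compHom W hW P := by
  rw [compHom, RatFunc.liftRingHom_apply]
  rfl

@[simp] theorem compHom_C {W : RatFunc ℂ} (hW : NonConst W) (c : ℂ) :
    compHom W hW (RatFunc.C c) = RatFunc.C c := by
  rw [← comp_eq_compHom, comp, RatFunc.eval_C]

@[simp] theorem compHom_X {W : RatFunc ℂ} (hW : NonConst W) :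
    compHom W hW RatFunc.X = W := by
  rw [← comp_eq_compHom, comp, RatFunc.eval_X]

theorem compHom_algebraMap {W : RatFunc ℂ} (hW : NonConst W) (q : Polynomial ℂ) :
    compHom W hW (algebraMap _ _ q) = q.eval₂ RatFunc.C W := by
  rw [← comp_eq_compHom, comp, RatFunc.eval_algebraMap]
  rfl

theorem ratFunc_ringHom_ext {K F : Type*} [Field K] [Field F] {f g : RatFunc K →+* F}
    (hC : ∀ c, f (RatFunc.C c) = g (RatFunc.C c)) (hX : f RatFunc.X = g RatFunc.X) : f = g := by
  apply IsLocalization.ringHom_ext (nonZeroDivisors (Polynomial K))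
  apply Polynomial.ringHom_ext
  · simpa using hC
  · simpa using hX

theorem NonConst.map {f : RatFunc ℂ →+* RatFunc ℂ} {W : RatFunc ℂ} (hW : NonConst W)
    (τ : ℂ ≃ ℂ) (hf : ∀ c, f (RatFunc.C c) = RatFunc.C (τ c)) : NonConst (f W) := by
  intro c h
  refine hW (τ.symm c) (f.injective ?_)
  rw [h, hf, Equiv.apply_symm_apply]

theorem compHom_comp {V W : RatFunc ℂ} (hV : NonConst V) (hW : NonConst W)
    (hVW : NonConst (compHom W hW V)) :
    (compHom W hW).comp (compHom V hV) = compHom (compHom W hW V) hVW :=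
  ratFunc_ringHom_ext (by simp) (by simp)

theorem nonConst_compHom {V W : RatFunc ℂ} (hV : NonConst V) (hW : NonConst W) :
    NonConst (compHom W hW V) := hV.map (Equiv.refl _) (by simp)

/-- This also holds at a pole c of P, where division by zero gives 0. It rules out constant W when L
is non-constant. -/
theorem comp_C (P : RatFunc ℂ) (c : ℂ) : ∃ d : ℂ, comp P (RatFunc.C c) = RatFunc.C d :=
  ⟨P.num.eval c / P.denom.eval c, by
    simp only [comp, RatFunc.eval, Polynomial.eval₂_hom, map_div₀]⟩

/-! ### Möbius transformations -/

/-- The Möbius transformation `(a x + b) / (c x + d)` applied to `W`. -/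
noncomputable def mob (a b c d : ℂ) (W : RatFunc ℂ) : RatFunc ℂ :=
  (RatFunc.C a * W + RatFunc.C b) / (RatFunc.C c * W + RatFunc.C d)

theorem NonConst.affine_ne_zero {W : RatFunc ℂ} (hW : NonConst W) {c d : ℂ} (h : c ≠ 0 ∨ d ≠ 0) :
    RatFunc.C c * W + RatFunc.C d ≠ 0 := by
  intro h0
  by_cases hc : c = 0
  · subst hc
    simp at h0
    simp_all
  · have hc' : RatFunc.C c ≠ 0 := by simpa using hc
    apply hW (-d / c)
    rw [map_div₀, map_neg, eq_div_iff hc']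
    linear_combination h0

theorem det_row {a b c d : ℂ} (h : a * d - b * c ≠ 0) : c ≠ 0 ∨ d ≠ 0 := by
  by_contra! h'
  simp [h'] at h

theorem mob_mob {W : RatFunc ℂ} (hW : NonConst W) {a b c d a' b' c' d' : ℂ}
    (h : a' * d' - b' * c' ≠ 0) :
    mob a b c d (mob a' b' c' d' W) =
      mob (a * a' + b * c') (a * b' + b * d') (c * a' + d * c') (c * b' + d * d') W := by
  have h1 := hW.affine_ne_zero (det_row h)
  unfold mob
  have e : ∀ x y : ℂ, RatFunc.C x * ((RatFunc.C a' * W + RatFunc.C b') /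
      (RatFunc.C c' * W + RatFunc.C d')) + RatFunc.C y =
      (RatFunc.C (x * a' + y * c') * W + RatFunc.C (x * b' + y * d')) /
        (RatFunc.C c' * W + RatFunc.C d') := by
    intro x y
    rw [eq_div_iff h1, add_mul, mul_assoc, div_mul_cancel₀ _ h1]
    simp only [map_add, map_mul]
    ring
  rw [e, e, div_div_div_cancel_right₀ h1]

theorem mob_id {W : RatFunc ℂ} {k : ℂ} (hk : k ≠ 0) : mob k 0 0 k W = W := by
  have : RatFunc.C k ≠ 0 := by simpa using hk
  simp [mob, this]

/-- The adjugate matrix inverts up to the scalar ad - bc, and scalar matrices act trivially. -/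
theorem mob_inv {W : RatFunc ℂ} (hW : NonConst W) {a b c d : ℂ} (h : a * d - b * c ≠ 0) :
    mob d (-b) (-c) a (mob a b c d W) = W := by
  rw [mob_mob hW h]
  convert mob_id (W := W) h using 2 <;> ring

theorem NonConst.mob {W : RatFunc ℂ} (hW : NonConst W) {a b c d : ℂ} (h : a * d - b * c ≠ 0) :
    NonConst (mob a b c d W) := by
  intro k hk
  have := mob_inv hW h
  rw [hk] at this
  apply hW ((d * k + -b) / (-c * k + a))
  rw [← this]
  simp [TrigDecomp.mob]

theorem map_mob (f : RatFunc ℂ →+* RatFunc ℂ) (τ : ℂ → ℂ)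
    (hf : ∀ c, f (RatFunc.C c) = RatFunc.C (τ c)) (a b c d : ℂ) (W : RatFunc ℂ) :
    f (mob a b c d W) = mob (τ a) (τ b) (τ c) (τ d) (f W) := by
  simp [mob, hf]

theorem comp_mob {W : RatFunc ℂ} (hW : NonConst W) (a b c d : ℂ) (V : RatFunc ℂ) :
    comp (mob a b c d V) W = mob a b c d (comp V W) := by
  rw [comp_eq_compHom hW, comp_eq_compHom hW]
  exact map_mob _ id (by simp) a b c d V

theorem comp_X (W : RatFunc ℂ) : comp RatFunc.X W = W := RatFunc.eval_X _ _

theorem nonConst_X : NonConst RatFunc.X := by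
  intro c h
  have := congrArg RatFunc.intDegree h
  simp at this

/-- The reduced numerator and denominator divide linear polynomials, and degree 0 would make the
transformation constant. -/
theorem ratDegree_mob {a b c d : ℂ} (h : a * d - b * c ≠ 0) :
    ratDegree (mob a b c d RatFunc.X) = 1 := by
  have hq : (Polynomial.C c * Polynomial.X + Polynomial.C d : Polynomial ℂ) ≠ 0 := by
    intro h0
    have h1 := congrArg (Polynomial.coeff · 0) h0
    have h2 := congrArg (Polynomial.coeff · 1) h0
    simp [Polynomial.coeff_C] at h1 h2
    simp [h1, h2] at h
  have hp : (Polynomial.C a * Polynomial.X + Polynomial.C b : Polynomial ℂ) ≠ 0 := by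
    intro h0
    have h1 := congrArg (Polynomial.coeff · 0) h0
    have h2 := congrArg (Polynomial.coeff · 1) h0
    simp [Polynomial.coeff_C] at h1 h2
    simp [h1, h2] at h
  have e : mob a b c d RatFunc.X =
      algebraMap _ _ (Polynomial.C a * Polynomial.X + Polynomial.C b : Polynomial ℂ) /
        algebraMap _ _ (Polynomial.C c * Polynomial.X + Polynomial.C d : Polynomial ℂ) := by
    simp [mob]
  have hn := Polynomial.natDegree_le_of_dvd (e ▸ RatFunc.num_div_dvd _ hq) hp
  have hd := Polynomial.natDegree_le_of_dvd (e ▸ RatFunc.denom_div_dvd _ _) hq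
  apply le_antisymm
  · exact max_le (hn.trans (Polynomial.natDegree_linear_le))
      (hd.trans (Polynomial.natDegree_linear_le))
  · by_contra! h0
    have h1 : (mob a b c d RatFunc.X).num.natDegree = 0 := by unfold ratDegree at h0; omega
    have h2 : (mob a b c d RatFunc.X).denom.natDegree = 0 := by unfold ratDegree at h0; omega
    have h3 := RatFunc.num_div_denom (mob a b c d RatFunc.X)
    rw [Polynomial.eq_C_of_natDegree_eq_zero h1, Polynomial.eq_C_of_natDegree_eq_zero h2] at h3
    apply nonConst_X.mob h _
    rw [← h3, RatFunc.algebraMap_C, RatFunc.algebraMap_C, ← map_div₀]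

theorem isCompInverse_mob {a b c d : ℂ} (h : a * d - b * c ≠ 0) :
    IsCompInverse (mob a b c d RatFunc.X) (mob d (-b) (-c) a RatFunc.X) := by
  have h' : d * a - -b * -c ≠ 0 := by rwa [neg_mul_neg, mul_comm d]
  constructor
  · rw [comp_mob (nonConst_X.mob h'), comp_X]
    simpa using mob_inv nonConst_X h'
  · rw [comp_mob (nonConst_X.mob h), comp_X]
    exact mob_inv nonConst_X h

/-! ### The involution `R ↦ R̄(1/z)` -/

theorem mapCoeff_algebraMap {K F : Type} [Field K] [Field F] (σ : K →+* F) (p : Polynomial K) :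
    mapCoeff σ (algebraMap _ _ p) = algebraMap _ _ (p.map σ) := by
  rw [mapCoeff, ← div_one (algebraMap (Polynomial K) (RatFunc K) p),
    ← map_one (algebraMap (Polynomial K) (RatFunc K)), RatFunc.coe_mapRingHom_eq_coe_map,
    RatFunc.map_apply_div]
  simp

theorem mapCoeff_C {K F : Type} [Field K] [Field F] (σ : K →+* F) (c : K) :
    mapCoeff σ (RatFunc.C c) = RatFunc.C (σ c) := by
  rw [← RatFunc.algebraMap_C, mapCoeff_algebraMap, Polynomial.map_C, RatFunc.algebraMap_C]

theorem mapCoeff_X {K F : Type} [Field K] [Field F] (σ : K →+* F) :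
    mapCoeff σ RatFunc.X = RatFunc.X := by
  rw [← RatFunc.algebraMap_X, mapCoeff_algebraMap, Polynomial.map_X, RatFunc.algebraMap_X]

theorem nonConst_X_inv : NonConst RatFunc.X⁻¹ := by
  intro c h
  apply nonConst_X c⁻¹
  rw [map_inv₀, ← h, inv_inv]

/-- The semilinear involution `R ↦ R̄(1/z)` of `ℂ(z)`. -/
noncomputable def sigma : RatFunc ℂ →+* RatFunc ℂ :=
  (compHom RatFunc.X⁻¹ nonConst_X_inv).comp conjRat

theorem mem_LRField {R : RatFunc ℂ} : R ∈ LRField ↔ sigma R = R := by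
  rw [LRField, Set.mem_ofPred_eq, comp_eq_compHom nonConst_X_inv]
  rfl

@[simp] theorem sigma_C (c : ℂ) : sigma (RatFunc.C c) = RatFunc.C (starRingEnd ℂ c) := by
  simp [sigma, conjRat, mapCoeff_C]

@[simp] theorem sigma_X : sigma RatFunc.X = RatFunc.X⁻¹ := by
  simp [sigma, conjRat, mapCoeff_X]

@[simp] theorem sigma_sigma (R : RatFunc ℂ) : sigma (sigma R) = R := by
  have : sigma.comp sigma = RingHom.id _ := ratFunc_ringHom_ext (by simp) (by simp)
  exact congrArg (fun f => f R) this

theorem NonConst.sigma {W : RatFunc ℂ} (hW : NonConst W) : NonConst (sigma W) :=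
  hW.map starRingAut.toEquiv (by simp)

theorem sigma_comp {W : RatFunc ℂ} (hW : NonConst W) (P : RatFunc ℂ) :
    sigma (comp P W) = comp (conjRat P) (sigma W) := by
  rw [comp_eq_compHom hW, comp_eq_compHom hW.sigma]
  have : sigma.comp (compHom W hW) = (compHom (TrigDecomp.sigma W) hW.sigma).comp conjRat :=
    ratFunc_ringHom_ext (by simp [conjRat, mapCoeff_C]) (by simp [conjRat, mapCoeff_X])
  exact congrArg (fun f => f P) this

/-- A rational function invariant under conjugation of its coefficients is real. -/
theorem exists_ofRealRat_of_conjRat_eq {P : RatFunc ℂ} (hP : conjRat P = P) :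
    ∃ Q : RatFunc ℝ, ofRealRat Q = P := by
  have key : ∀ q : Polynomial ℂ, q.map (starRingEnd ℂ) = q →
      ∃ r : Polynomial ℝ, r.map (algebraMap ℝ ℂ) = q := by
    intro q hq
    rw [← Polynomial.mem_lifts, Polynomial.lifts_iff_coeff_lifts]
    intro n
    have := congrArg (Polynomial.coeff · n) hq
    rw [Polynomial.coeff_map] at this
    exact ⟨_, Complex.conj_eq_iff_re.1 this⟩
  have inv : ∀ q : Polynomial ℂ, (q.map (starRingEnd ℂ)).map (starRingEnd ℂ) = q := by
    intro q
    ext n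
    simp
  -- Expand P = N/D to ND̄/(DD̄): the denominator is real, hence so is the numerator, which is P
  -- times it.
  set D' := P.denom.map (starRingEnd ℂ) with hD'
  have hD'0 : D' ≠ 0 := (Polynomial.map_ne_zero_iff (starRingEnd ℂ).injective).2 P.denom_ne_zero
  have hd : algebraMap _ (RatFunc ℂ) P.denom ≠ 0 := RatFunc.algebraMap_ne_zero P.denom_ne_zero
  have e : algebraMap _ (RatFunc ℂ) (P.num * D') =
      P * algebraMap _ (RatFunc ℂ) (P.denom * D') := by
    have hn : P * algebraMap _ (RatFunc ℂ) P.denom = algebraMap _ (RatFunc ℂ) P.num := by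
      nth_rewrite 1 [← RatFunc.num_div_denom P]
      exact div_mul_cancel₀ _ hd
    rw [map_mul, map_mul, ← mul_assoc, hn]
  obtain ⟨d, hd⟩ := key (P.denom * D') (by rw [Polynomial.map_mul, hD', inv, mul_comm])
  obtain ⟨m, hm⟩ := key (P.num * D') (by
    apply RatFunc.algebraMap_injective ℂ
    rw [← mapCoeff_algebraMap, e, map_mul, mapCoeff_algebraMap, ← hd]
    change conjRat P * _ = _
    rw [hP, Polynomial.map_map]
    congr 3
    ext; simp)
  refine ⟨algebraMap _ _ m / algebraMap _ _ d, ?_⟩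
  rw [ofRealRat, map_div₀, mapCoeff_algebraMap, mapCoeff_algebraMap, hm, hd, e,
    mul_div_cancel_right₀]
  exact RatFunc.algebraMap_ne_zero (mul_ne_zero P.denom_ne_zero hD'0)

/-! ### Laurent polynomials -/

@[simp] theorem toRat_C (c : ℂ) : toRat (C c) = RatFunc.C c := eval₂_C _ _ _

@[simp] theorem toRat_T (k : ℤ) : toRat (T k) = RatFunc.X ^ k := by
  rw [toRat, eval₂_T]
  simp

theorem toRat_toLaurent (p : Polynomial ℂ) :
    toRat (Polynomial.toLaurent p) = algebraMap _ _ p := by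
  have : toRat.comp Polynomial.toLaurent = algebraMap (Polynomial ℂ) (RatFunc ℂ) := by
    apply Polynomial.ringHom_ext <;> simp
  exact congrArg (fun f => f p) this

theorem laurent_ringHom_ext {S : Type*} [CommRing S] {f g : LaurentPolynomial ℂ →+* S}
    (hC : ∀ c, f (C c) = g (C c)) (hT : ∀ k, f (T k) = g (T k)) : f = g := by
  refine RingHom.ext fun L => ?_
  induction L using LaurentPolynomial.induction_on' with
  | add p q hp hq => rw [map_add, map_add, hp, hq]
  | C_mul_T n a => rw [map_mul, map_mul, hC, hT]

/-- The involution `L ↦ L̄(1/z)` on Laurent polynomials. -/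
noncomputable def starL : LaurentPolynomial ℂ →+* LaurentPolynomial ℂ :=
  LaurentPolynomial.eval₂ (C.comp (starRingEnd ℂ)) 
    ⟨T (-1), T 1, by rw [← T_add, neg_add_cancel, T_zero], by rw [← T_add, add_neg_cancel, T_zero]⟩

@[simp] theorem starL_C (c : ℂ) : starL (C c) = C (starRingEnd ℂ c) := eval₂_C _ _ _

@[simp] theorem starL_T (k : ℤ) : starL (T k) = T (-k) := by
  rw [starL, eval₂_T]
  induction k using Int.negInduction with
  | nat n => simp [T_pow]
  | neg _ n => simp [T_pow]

theorem sigma_toRat (L : LaurentPolynomial ℂ) : sigma (toRat L) = toRat (starL L) := by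
  have : sigma.comp toRat = toRat.comp starL := laurent_ringHom_ext (by simp) (by simp)
  exact congrArg (fun f => f L) this

/-- This symmetry transfers vanishing at ∞ to vanishing at 0. -/
theorem coeff_starL (L : LaurentPolynomial ℂ) (k : ℤ) :
    (starL L).coeff k = starRingEnd ℂ (L.coeff (-k)) := by
  induction L using LaurentPolynomial.induction_on' with
  | add p q hp hq => simp [hp, hq]
  | C_mul_T n a =>
    rw [map_mul, starL_C, starL_T, ← single_eq_C_mul_T, ← single_eq_C_mul_T]
    simp only [AddMonoidAlgebra.coeff_single, Finsupp.single_apply]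
    by_cases h : n = -k
    · simp [h]
    · have : ¬ -n = k := by omega
      simp [h, this]

/-- On the unit circle 1/z is the conjugate of z. -/
theorem circleEval_starL (L : LaurentPolynomial ℂ) (θ : ℝ) :
    circleEval (starL L) θ = starRingEnd ℂ (circleEval L θ) := by
  simp only [circleEval_apply]
  induction L using LaurentPolynomial.induction_on' with
  | add p q hp hq => simp only [map_add, hp, hq]
  | C_mul_T n a =>
    simp only [map_mul, starL_C, starL_T, eval₂_C, eval₂_T, RingHom.id_apply]
    simp [← Complex.exp_conj, Complex.exp_neg]

theorem starL_of_mem_LR {L : LaurentPolynomial ℂ} (hL : L ∈ LR) : starL L = L := by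
  obtain ⟨p, rfl⟩ := hL
  apply circleEval_injective
  funext θ
  rw [circleEval_starL]
  change starRingEnd ℂ (circleEval (phi p) θ) = circleEval (phi p) θ
  rw [circleEval_phi]
  exact Complex.conj_ofReal _

theorem C_real_mem_LR (r : ℝ) : C (r : ℂ) ∈ LR := LR.algebraMap_mem r

/-- The set `LR` + i `LR` is closed under sums and products, and contains ℂ and z^{±1} = cos θ ± i
sin θ. -/
theorem exists_re_im (L : LaurentPolynomial ℂ) : ∃ x ∈ LR, ∃ y ∈ LR, L = x + C Complex.I * y := by
  have hI : (C Complex.I : LaurentPolynomial ℂ) * C Complex.I = -1 := by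
    rw [← map_mul, Complex.I_mul_I, map_neg, map_one]
  have hcos : cosL ∈ LR := ⟨cosRt, phi_cos⟩
  have hsin : sinL ∈ LR := ⟨sinRt, phi_sin⟩
  have hmul : ∀ L M : LaurentPolynomial ℂ, (∃ x ∈ LR, ∃ y ∈ LR, L = x + C Complex.I * y) →
      (∃ x ∈ LR, ∃ y ∈ LR, M = x + C Complex.I * y) →
      ∃ x ∈ LR, ∃ y ∈ LR, L * M = x + C Complex.I * y := by
    rintro _ _ ⟨x, hx, y, hy, rfl⟩ ⟨x', hx', y', hy', rfl⟩
    refine ⟨x * x' - y * y', sub_mem (mul_mem hx hx') (mul_mem hy hy'),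
      x * y' + y * x', add_mem (mul_mem hx hy') (mul_mem hy hx'), ?_⟩
    linear_combination y * y' * hI
  have hT1 : (T 1 : LaurentPolynomial ℂ) = cosL + C Complex.I * sinL := by
    have h1 : (C Complex.I : LaurentPolynomial ℂ) * C (1 / (2 * Complex.I)) = C (1 / 2) := by
      rw [← map_mul]; congr 1; field_simp
    have h2 : (C (1 / 2) : LaurentPolynomial ℂ) + C (1 / 2) = 1 := by
      rw [← map_add]; norm_num
    rw [cosL, sinL]
    linear_combination (T (-1) - T 1) * h1 - T 1 * h2
  have hTm1 : (T (-1) : LaurentPolynomial ℂ) = cosL + C Complex.I * (-sinL) := by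
    have h1 : (C Complex.I : LaurentPolynomial ℂ) * C (1 / (2 * Complex.I)) = C (1 / 2) := by
      rw [← map_mul]; congr 1; field_simp
    have h2 : (C (1 / 2) : LaurentPolynomial ℂ) + C (1 / 2) = 1 := by
      rw [← map_add]; norm_num
    rw [cosL, sinL]
    linear_combination (T 1 - T (-1)) * h1 - T (-1) * h2
  induction L using LaurentPolynomial.induction_on with
  | h_C a =>
    refine ⟨C (a.re : ℂ), C_real_mem_LR _, C (a.im : ℂ), C_real_mem_LR _, ?_⟩
    rw [← map_mul, ← map_add, mul_comm, Complex.re_add_im]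
  | h_add hp hq =>
    obtain ⟨x, hx, y, hy, rfl⟩ := hp
    obtain ⟨x', hx', y', hy', rfl⟩ := hq
    exact ⟨x + x', add_mem hx hx', y + y', add_mem hy hy', by ring⟩
  | h_C_mul_T n a h =>
    rw [T_add, ← mul_assoc]
    exact hmul _ _ h ⟨_, hcos, _, hsin, hT1⟩
  | h_C_mul_T_Z n a h =>
    rw [T_sub, ← mul_assoc]
    exact hmul _ _ h ⟨_, hcos, _, neg_mem hsin, hTm1⟩

/-- Writing L = x + iy with x, y in `LR`, invariance reads x - iy = x + iy, so iy = 0. -/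
theorem mem_LR_of_starL {L : LaurentPolynomial ℂ} (hL : starL L = L) : L ∈ LR := by
  obtain ⟨x, hx, y, hy, rfl⟩ := exists_re_im L
  rw [map_add, map_mul, starL_C, starL_of_mem_LR hx, starL_of_mem_LR hy, Complex.conj_I,
    map_neg] at hL
  have h2 : (C (1 / 2) : LaurentPolynomial ℂ) + C (1 / 2) = 1 := by
    rw [← map_add]; norm_num
  have : C Complex.I * y = 0 := by
    linear_combination -C (1 / 2) * hL - C Complex.I * y * h2
  rwa [this, add_zero]

/-- The fixed field of the involution `R ↦ R̄(1/z)` is `φ(ℝ_t(θ))`. -/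
theorem exists_phiField_of_sigma {R : RatFunc ℂ} (hR : sigma R = R) :
    ∃ w : RtField, phiField w = R := by
  have hd : algebraMap _ (RatFunc ℂ) R.denom ≠ 0 := RatFunc.algebraMap_ne_zero R.denom_ne_zero
  set G := Polynomial.toLaurent R.denom with hG
  set F := Polynomial.toLaurent R.num with hF
  have hG0 : toRat G ≠ 0 := by rwa [hG, toRat_toLaurent]
  have hsG0 : toRat (starL G) ≠ 0 := by
    rw [← sigma_toRat]
    exact (map_ne_zero sigma).2 hG0
  have hRG : R * toRat G = toRat F := by
    rw [hG, hF, toRat_toLaurent, toRat_toLaurent]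
    nth_rewrite 1 [← RatFunc.num_div_denom R]
    exact div_mul_cancel₀ _ hd
  have hss : ∀ L, starL (starL L) = L := by
    intro L
    apply toRat_injective
    rw [← sigma_toRat, ← sigma_toRat, sigma_sigma]
  -- With G* = `starL G`, R = FG*/(GG*). The denominator is fixed, so the numerator is too, and both
  -- lie in `LR`.
  have e : toRat (F * starL G) = R * toRat (G * starL G) := by
    rw [map_mul, map_mul, ← hRG, mul_assoc]
  obtain ⟨d, hd⟩ := mem_LR_of_starL (L := G * starL G) (by rw [map_mul, hss, mul_comm])
  obtain ⟨m, hm⟩ := mem_LR_of_starL (L := F * starL G) (by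
    apply toRat_injective
    rw [← sigma_toRat, e, map_mul, sigma_toRat, hR, map_mul, hss, mul_comm (starL G)])
  refine ⟨algebraMap _ _ m / algebraMap _ _ d, ?_⟩
  change phi d = _ at hd
  change phi m = _ at hm
  rw [map_div₀, phiField_algebraMap, phiField_algebraMap, hm, hd, e, mul_div_cancel_right₀]
  rw [map_mul]
  exact mul_ne_zero hG0 hsG0

/-! ### The place at infinity -/

open Classical in
/-- The valuation of `ℂ(z)` at infinity. -/
noncomputable def vInf : Valuation (RatFunc ℂ) (WithZero (Multiplicative ℤ)) :=
  RatFunc.inftyValuation ℂ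

theorem vInf_C {c : ℂ} (hc : c ≠ 0) : vInf (RatFunc.C c) = 1 := by
  classical exact RatFunc.inftyValuation.C ℂ hc

theorem vInf_C_le (c : ℂ) : vInf (RatFunc.C c) ≤ 1 := by
  by_cases hc : c = 0
  · simp [hc]
  · exact (vInf_C hc).le

theorem vInf_X_zpow (k : ℤ) : vInf (RatFunc.X ^ k) = WithZero.exp k := by
  classical exact RatFunc.inftyValuation.X_zpow ℂ k

theorem vInf_algebraMap {p : Polynomial ℂ} (hp : p ≠ 0) :
    vInf (algebraMap _ _ p) = WithZero.exp (p.natDegree : ℤ) := by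
  classical exact RatFunc.inftyValuation.polynomial ℂ hp

/-- `vInf` is the exponential of the top degree; multiplying by a power of z reduces to polynomials.
-/
theorem coeff_eq_zero_of_vInf_lt {f : LaurentPolynomial ℂ} {m : ℤ}
    (hf : vInf (toRat f) < WithZero.exp m) {k : ℤ} (hk : m ≤ k) : f.coeff k = 0 := by
  obtain ⟨n, F, hF⟩ := LaurentPolynomial.exists_T_pow f
  by_cases hF0 : F = 0
  · rw [hF0, map_zero] at hF
    rw [(LaurentPolynomial.isUnit_T (n : ℤ)).mul_left_eq_zero.mp hF.symm]
    rfl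
  have h1 := congrArg (fun x => vInf (toRat x)) hF
  simp only [toRat_toLaurent, map_mul, toRat_T] at h1
  rw [vInf_algebraMap hF0, vInf_X_zpow] at h1
  have h2 : WithZero.exp (F.natDegree : ℤ) < WithZero.exp (m + n) := by
    rw [h1, WithZero.exp_add]
    gcongr
    exact WithZero.exp_pos
  rw [WithZero.exp_lt_exp] at h2
  have h3 : (f * T n).coeff (k + n) = f.coeff k := by
    rw [T, AddMonoidAlgebra.coeff_mul_single_eq_coeff_mul k (by simp), mul_one]
  rw [← h3, ← hF, ← Finsupp.notMem_support_iff, support_coeff_toLaurent, Finset.mem_map]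
  rintro ⟨j, hj, hjk⟩
  have := Polynomial.le_natDegree_of_mem_supp j hj
  simp at hjk
  omega

/-- Each term with i < m has value at most that of w^i. Stating the bound on coefficients lets m = 0
mean R = 0, which occurs below when N is linear. -/
theorem vInf_eval₂_lt {R : Polynomial ℂ} {m : ℕ} (hR : ∀ i, m ≤ i → R.coeff i = 0)
    {w : RatFunc ℂ} (hw : 1 < vInf w) : vInf (R.eval₂ RatFunc.C w) < vInf w ^ m := by
  have h0 : vInf w ^ m ≠ 0 := pow_ne_zero _ (zero_lt_one.trans hw).ne'
  rw [Polynomial.eval₂_eq_sum_range]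
  refine vInf.map_sum_lt h0 fun i _ => ?_
  by_cases hi : m ≤ i
  · simpa [hR i hi] using zero_lt_iff.2 h0
  · rw [map_mul, map_pow]
    calc _ ≤ 1 * vInf w ^ i := by gcongr; exact vInf_C_le _
      _ < _ := by rw [one_mul]; exact pow_lt_pow_right₀ hw (not_le.1 hi)

theorem vInf_eval₂_le_one (N : Polynomial ℂ) {w : RatFunc ℂ} (hw : vInf w ≤ 1) :
    vInf (N.eval₂ RatFunc.C w) ≤ 1 := by
  rw [Polynomial.eval₂_eq_sum_range]
  refine vInf.map_sum_le fun i _ => ?_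
  rw [map_mul, map_pow]
  exact mul_le_one' (vInf_C_le _) (pow_le_one' hw i)

/-- Factor u^n - (kw)^n as the product of u - ηkw over the n-th roots of unity η. Each factor has
value at most g = `vInf w`, and the product is below g^(n-1), so some factor is below g. Any other
factor differs from it by a nonzero constant times w, hence has value exactly g. These account for
g^(n-1), leaving the exceptional factor below 1. -/
theorem exists_vInf_sub_lt {u w : RatFunc ℂ} (huw : vInf u = vInf w) (hw : 1 < vInf w) {n : ℕ}
    (hn : n ≠ 0) (k : ℂ) (hk : ‖k‖ = 1)
    (h : vInf (u ^ n - (RatFunc.C k * w) ^ n) < vInf w ^ (n - 1)) :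
    ∃ ζ : ℂ, ‖ζ‖ = 1 ∧ vInf (u - RatFunc.C ζ * w) < 1 := by
  classical
  have : NeZero n := ⟨hn⟩
  have hk0 : k ≠ 0 := by rintro rfl; simp at hk
  set g := vInf w with hg
  have hprim := (Complex.isPrimitiveRoot_exp n hn).map_of_injective
    (f := RatFunc.C) (RingHom.injective _)
  have hconst : ∀ η ∈ Polynomial.nthRootsFinset n (1 : RatFunc ℂ),
      ∃ c : ℂ, ‖c‖ = 1 ∧ RatFunc.C c = η := by
    intro η hη
    rw [Polynomial.mem_nthRootsFinset (Nat.pos_of_ne_zero hn)] at hη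
    obtain ⟨i, -, hi⟩ := hprim.eq_pow_of_pow_eq_one hη
    refine ⟨_, ?_, (map_pow _ _ _).trans hi⟩
    rw [norm_pow, (Complex.isPrimitiveRoot_exp n hn).norm'_eq_one hn, one_pow]
  rw [hprim.pow_sub_pow_eq_prod_sub_mul _ _ (Nat.pos_of_ne_zero hn), map_prod] at h
  have hkw : ∀ c : ℂ, vInf (RatFunc.C c * (RatFunc.C k * w)) ≤ g := by
    intro c
    rw [map_mul, map_mul, vInf_C hk0, one_mul]
    exact mul_le_of_le_one_left' (vInf_C_le c)
  have hle : ∀ η ∈ Polynomial.nthRootsFinset n (1 : RatFunc ℂ),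
      vInf (u - η * (RatFunc.C k * w)) ≤ g := by
    intro η hη
    obtain ⟨c, -, rfl⟩ := hconst η hη
    exact (vInf.map_sub _ _).trans (max_le huw.le (hkw c))
  obtain ⟨η, hη, hlt⟩ : ∃ η ∈ Polynomial.nthRootsFinset n (1 : RatFunc ℂ),
      vInf (u - η * (RatFunc.C k * w)) < g := by
    by_contra! hcon
    rw [Finset.prod_congr rfl fun η hη => le_antisymm (hle η hη) (hcon η hη), Finset.prod_const,
      hprim.card_nthRootsFinset] at h
    exact absurd h (not_lt.2 (pow_le_pow_right₀ hw.le (Nat.sub_le _ _)))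
  have heq : ∀ η' ∈ (Polynomial.nthRootsFinset n (1 : RatFunc ℂ)).erase η,
      vInf (u - η' * (RatFunc.C k * w)) = g := by
    intro η' hη'
    obtain ⟨hne, hmem⟩ := Finset.mem_erase.1 hη'
    obtain ⟨c, -, rfl⟩ := hconst η hη
    obtain ⟨c', -, rfl⟩ := hconst η' hmem
    have hcc : c - c' ≠ 0 := fun h0 => hne (by rw [sub_eq_zero.1 h0])
    have e : u - RatFunc.C c' * (RatFunc.C k * w) =
        (u - RatFunc.C c * (RatFunc.C k * w)) + RatFunc.C (c - c') * (RatFunc.C k * w) := by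
      rw [map_sub]; ring
    have e2 : vInf (RatFunc.C (c - c') * (RatFunc.C k * w)) = g := by
      rw [map_mul, map_mul, vInf_C hk0, vInf_C hcc, one_mul, one_mul]
    rw [e, vInf.map_add_eq_of_lt_right (by rwa [e2]), e2]
  rw [← Finset.mul_prod_erase _ _ hη, Finset.prod_congr rfl heq, Finset.prod_const,
    Finset.card_erase_of_mem hη, hprim.card_nthRootsFinset] at h
  obtain ⟨c, hc, rfl⟩ := hconst η hη
  refine ⟨c * k, by rw [norm_mul, hc, hk, one_mul], ?_⟩
  rw [map_mul, mul_assoc]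
  by_contra! hcon
  exact absurd h (not_lt.2 (le_mul_of_one_le_left' hcon))

/-- If `N(w) = N̄(u)` for a polynomial `N`, then suitable translates of `u` and `w` are proportional
up to terms vanishing at infinity. -/
theorem exists_translate_vInf_lt {N : Polynomial ℂ} (hN : N.natDegree ≠ 0) {u w : RatFunc ℂ}
    (h : N.eval₂ RatFunc.C w = (N.map (starRingEnd ℂ)).eval₂ RatFunc.C u)
    (hu : 1 < vInf u) (hw : 1 < vInf w) :
    ∃ b ζ : ℂ, ‖ζ‖ = 1 ∧
      vInf ((u + RatFunc.C (starRingEnd ℂ b)) - RatFunc.C ζ * (w + RatFunc.C b)) < 1 := by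
  set n := N.natDegree with hn
  set p := N.leadingCoeff with hp
  have hp0 : p ≠ 0 := by
    rw [hp, Ne, Polynomial.leadingCoeff_eq_zero]
    rintro rfl
    simp at hn
    exact hN hn
  have hpbar : starRingEnd ℂ p ≠ 0 := (map_ne_zero _).2 hp0
  have hn0 : (n : ℂ) ≠ 0 := Nat.cast_ne_zero.2 hN
  -- This b completes the n-th power: N - p(x + b)^n has no term of degree n - 1 or more.
  set b := N.coeff (n - 1) / (n * p) with hb
  set R := N - Polynomial.C p * (Polynomial.X + Polynomial.C b) ^ n with hR
  have hRc : ∀ i, n - 1 ≤ i → R.coeff i = 0 := by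
    intro i hi
    rw [hR, Polynomial.coeff_sub, Polynomial.coeff_C_mul, Polynomial.coeff_X_add_C_pow]
    rcases lt_trichotomy i n with h1 | h1 | h1
    · obtain rfl : i = n - 1 := by omega
      rw [show n - (n - 1) = 1 by omega, Nat.choose_symm (by omega : 1 ≤ n), Nat.choose_one_right,
        hb]
      field_simp
      ring
    · subst h1
      simp [hp, hn]
    · rw [Polynomial.coeff_eq_zero_of_natDegree_lt h1, Nat.choose_eq_zero_of_lt h1]
      simp
  have hRc' : ∀ i, n - 1 ≤ i → (R.map (starRingEnd ℂ)).coeff i = 0 := by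
    intro i hi
    rw [Polynomial.coeff_map, hRc i hi, map_zero]
  have hNR : N = Polynomial.C p * (Polynomial.X + Polynomial.C b) ^ n + R := by rw [hR]; ring
  clear_value R b p
  clear hR hb
  set w1 := w + RatFunc.C b with hw1
  set u1 := u + RatFunc.C (starRingEnd ℂ b) with hu1
  have hvw : vInf w1 = vInf w := vInf.map_add_eq_of_lt_left ((vInf_C_le _).trans_lt hw)
  have hvu : vInf u1 = vInf u := vInf.map_add_eq_of_lt_left ((vInf_C_le _).trans_lt hu)
  have eL : N.eval₂ RatFunc.C w = RatFunc.C p * w1 ^ n + R.eval₂ RatFunc.C w := by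
    conv_lhs => rw [hNR]
    simp [hw1, Polynomial.eval₂_pow]
  have eR : (N.map (starRingEnd ℂ)).eval₂ RatFunc.C u =
      RatFunc.C (starRingEnd ℂ p) * u1 ^ n + (R.map (starRingEnd ℂ)).eval₂ RatFunc.C u := by
    conv_lhs => rw [hNR]
    simp [hu1, Polynomial.eval₂_map, Polynomial.eval₂_pow]
  have hRw := vInf_eval₂_lt hRc hw
  have hRu := vInf_eval₂_lt hRc' hu
  have hvL : vInf (N.eval₂ RatFunc.C w) = vInf w ^ n := by
    have e : vInf (RatFunc.C p * w1 ^ n) = vInf w ^ n := by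
      rw [map_mul, map_pow, vInf_C hp0, hvw, one_mul]
    rw [eL, vInf.map_add_eq_of_lt_left, e]
    rw [e]
    exact hRw.trans_le (pow_le_pow_right₀ hw.le (Nat.sub_le _ _))
  have hvR : vInf ((N.map (starRingEnd ℂ)).eval₂ RatFunc.C u) = vInf u ^ n := by
    have e : vInf (RatFunc.C (starRingEnd ℂ p) * u1 ^ n) = vInf u ^ n := by
      rw [map_mul, map_pow, vInf_C hpbar, hvu, one_mul]
    rw [eR, vInf.map_add_eq_of_lt_left, e]
    rw [e]
    exact hRu.trans_le (pow_le_pow_right₀ hu.le (Nat.sub_le _ _))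
  have huw : vInf u = vInf w :=
    (pow_left_inj₀ zero_le zero_le hN).1 (hvR.symm.trans ((congrArg vInf h.symm).trans hvL))
  -- With k^n = p/p̄, the leading terms p w1^n and p̄ u1^n combine to p̄(u1^n - (k w1)^n), which
  -- equals a difference of remainders.
  obtain ⟨k, hk⟩ := IsAlgClosed.exists_pow_nat_eq (p / starRingEnd ℂ p) (Nat.pos_of_ne_zero hN)
  have hk1 : ‖k‖ = 1 := by
    have := congrArg norm hk
    rw [norm_pow, norm_div, Complex.norm_conj, div_self (norm_ne_zero_iff.2 hp0)] at this
    exact (pow_eq_one_iff_of_nonneg (norm_nonneg k) hN).1 this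
  obtain ⟨ζ, hζ, hlt⟩ := exists_vInf_sub_lt (hvu.trans (huw.trans hvw.symm))
    (hvw.symm ▸ hw) hN k hk1 (by
      have hk' : RatFunc.C (starRingEnd ℂ p) * RatFunc.C k ^ n = RatFunc.C p := by
        rw [← map_pow, ← map_mul, hk, mul_div_cancel₀ _ hpbar]
      have e : RatFunc.C (starRingEnd ℂ p) * (u1 ^ n - (RatFunc.C k * w1) ^ n) =
          R.eval₂ RatFunc.C w - (R.map (starRingEnd ℂ)).eval₂ RatFunc.C u := by
        rw [eL, eR] at h
        rw [mul_pow]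
        linear_combination -h - w1 ^ n * hk'
      have e2 := congrArg vInf e
      rw [map_mul, vInf_C hpbar, one_mul] at e2
      rw [e2, hvw]
      refine (vInf.map_sub _ _).trans_lt (max_lt hRw ?_)
      rwa [← huw])
  exact ⟨b, ζ, hζ, hlt⟩

/-- Boundedness at ∞ kills the positive coefficients, and symmetry the negative ones. So a
non-constant fixed L has a pole at ∞. -/
theorem eq_C_of_vInf_le_one {L : LaurentPolynomial ℂ} (hL : starL L = L)
    (hv : vInf (toRat L) ≤ 1) : L = C (L.coeff 0) := by
  have hpos : ∀ k : ℤ, 0 < k → L.coeff k = 0 := fun k hk =>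
    coeff_eq_zero_of_vInf_lt (m := 1) (hv.trans_lt (by
      rw [← WithZero.exp_zero, WithZero.exp_lt_exp]; norm_num)) hk
  ext k
  rw [C_apply]
  split_ifs with h
  · rw [h]
  · rcases lt_or_gt_of_ne h with h | h
    · rw [← hL, coeff_starL, hpos _ (by omega), map_zero]
    · exact hpos k h

/-- The polynomial case: some affine function of `w` is invariant. -/
theorem exists_affine_of_polynomial {L w : LaurentPolynomial ℂ} (hL : starL L = L)
    (hLc : ∀ c, L ≠ C c) {N : Polynomial ℂ} (h : toRat L = N.eval₂ RatFunc.C (toRat w)) :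
    ∃ a b : ℂ, a ≠ 0 ∧ sigma (mob a b 0 1 (toRat w)) = mob a b 0 1 (toRat w) := by
  have hLv : 1 < vInf (toRat L) := not_le.1 fun h => hLc _ (eq_C_of_vInf_le_one hL h)
  have h' : toRat L = (N.map (starRingEnd ℂ)).eval₂ RatFunc.C (toRat (starL w)) := by
    have := congrArg sigma h
    rw [sigma_toRat, hL, Polynomial.hom_eval₂, sigma_toRat] at this
    rw [this, Polynomial.eval₂_map]
    congr 1
    ext; simp
  have hN : N.natDegree ≠ 0 := by
    intro h0
    rw [Polynomial.eq_C_of_natDegree_eq_zero h0, Polynomial.eval₂_C, ← toRat_C] at h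
    exact hLc _ (toRat_injective h)
  obtain ⟨b, ζ, hζ, hlt⟩ := exists_translate_vInf_lt hN (h.symm.trans h')
    (not_le.1 fun hle => absurd (h' ▸ vInf_eval₂_le_one _ hle) (not_le.2 hLv))
    (not_le.1 fun hle => absurd (h ▸ vInf_eval₂_le_one _ hle) (not_le.2 hLv))
  have hζζ : ζ * starRingEnd ℂ ζ = 1 := by rw [Complex.mul_conj']; simp [hζ]
  have hζ0 : ζ ≠ 0 := by rintro rfl; simp at hζ
  set f : LaurentPolynomial ℂ := starL (w + C b) - C ζ * (w + C b) with hf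
  have hss : ∀ L, starL (starL L) = L := by
    intro L
    apply toRat_injective
    rw [← sigma_toRat, ← sigma_toRat, sigma_sigma]
  have hCζ : (C ζ : LaurentPolynomial ℂ) * C (starRingEnd ℂ ζ) = 1 := by
    rw [← map_mul, hζζ, map_one]
  -- Since f is an eigenvector of `starL`, its negative coefficients vanish along with the positive
  -- ones.
  have hsf : starL f = - C (starRingEnd ℂ ζ) * f := by
    rw [hf, map_sub, hss, map_mul, starL_C]
    linear_combination (-(w + C b)) * hCζ
  have hfv : vInf (toRat f) < 1 := by
    convert hlt using 2
    simp [hf]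
  have hnn : ∀ k : ℤ, 0 ≤ k → f.coeff k = 0 := fun k hk =>
    coeff_eq_zero_of_vInf_lt (m := 0) (by rwa [WithZero.exp_zero]) hk
  have hf0 : f = 0 := by
    ext k
    rcases le_or_gt 0 k with h | h
    · exact hnn k h
    · have h1 : f = - C ζ * starL f := by rw [hsf]; linear_combination (-f) * hCζ
      rw [h1, ← map_neg, ← smul_eq_C_mul, AddMonoidAlgebra.coeff_smul, Finsupp.smul_apply,
        coeff_starL, hnn _ (by omega)]
      simp
  -- With c² = ζ and |c| = 1 one has c̄ζ = c, so c(w + b) is fixed.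
  obtain ⟨c, hc⟩ := IsAlgClosed.exists_pow_nat_eq ζ (by norm_num : 0 < 2)
  have hc1 : ‖c‖ = 1 := by
    have := congrArg norm hc
    rw [norm_pow, hζ] at this
    exact (pow_eq_one_iff_of_nonneg (norm_nonneg c) two_ne_zero).1 this
  have hcc : c * starRingEnd ℂ c = 1 := by rw [Complex.mul_conj']; simp [hc1]
  have hc0 : c ≠ 0 := by rintro rfl; simp at hc1
  refine ⟨c, c * b, hc0, ?_⟩
  have e : mob c (c * b) 0 1 (toRat w) = toRat (C c * (w + C b)) := by
    simp [mob]; ring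
  rw [e, sigma_toRat, map_mul, sub_eq_zero.1 hf0, starL_C, ← mul_assoc, ← map_mul]
  congr 4
  rw [← hc]
  linear_combination c * hcc

/-! ### Reduction to Laurent polynomials -/

theorem comp_assoc {V W : RatFunc ℂ} (hV : NonConst V) (hW : NonConst W) (P : RatFunc ℂ) :
    comp (comp P V) W = comp P (comp V W) := by
  rw [comp_eq_compHom hV, comp_eq_compHom hW, comp_eq_compHom hW,
    comp_eq_compHom (nonConst_compHom hV hW), ← compHom_comp hV hW]
  rfl

theorem mul_denom_eval₂ {W : RatFunc ℂ} (hW : NonConst W) (P : RatFunc ℂ) :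
    comp P W * P.denom.eval₂ RatFunc.C W = P.num.eval₂ RatFunc.C W :=
  div_mul_cancel₀ _ (hW.eval₂_ne_zero P.denom_ne_zero)

theorem num_eval_ne_zero {P : RatFunc ℂ} {a : ℂ} (ha : P.denom.eval a = 0) :
    P.num.eval a ≠ 0 := by
  intro h
  obtain ⟨x, y, hxy⟩ := P.isCoprime_num_denom
  have := congrArg (Polynomial.eval a) hxy
  simp [ha, h] at this

/-- A rational function satisfying a polynomial equation with unit leading coefficient over the
Laurent polynomials is a Laurent polynomial. -/
theorem exists_toRat_eq {L : LaurentPolynomial ℂ} {N D : Polynomial ℂ} {W : RatFunc ℂ}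
    (hdeg : D.natDegree < N.natDegree)
    (h : toRat L * D.eval₂ RatFunc.C W = N.eval₂ RatFunc.C W) : ∃ w, toRat w = W := by
  obtain ⟨k, F, hF⟩ := LaurentPolynomial.exists_T_pow L
  have hN : N.leadingCoeff ≠ 0 := by
    rw [Ne, Polynomial.leadingCoeff_eq_zero]
    rintro rfl
    simp at hdeg
  have hXk : (Polynomial.X ^ k : Polynomial ℂ) ≠ 0 := pow_ne_zero _ Polynomial.X_ne_zero
  -- With L = F/z^k, W is a root of z^k N(Y) - F(z) D(Y), whose leading coefficient is z^k lc(N)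
  -- because deg D < deg N. Hence z^k lc(N) W is integral over ℂ[z], so it is a polynomial.
  set p : Polynomial (Polynomial ℂ) := Polynomial.C (Polynomial.X ^ k) * N.map Polynomial.C -
    Polynomial.C F * D.map Polynomial.C with hp
  have hlead : p.leadingCoeff = Polynomial.X ^ k * Polynomial.C N.leadingCoeff := by
    rw [hp, Polynomial.leadingCoeff_sub_of_degree_lt, Polynomial.leadingCoeff_mul,
      Polynomial.leadingCoeff_C, Polynomial.leadingCoeff_map_of_injective Polynomial.C_injective]
    apply Polynomial.degree_lt_degree
    refine (Polynomial.natDegree_C_mul_le _ _).trans_lt ?_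
    rw [Polynomial.natDegree_C_mul hXk, Polynomial.natDegree_map_eq_of_injective
      Polynomial.C_injective, Polynomial.natDegree_map_eq_of_injective Polynomial.C_injective]
    exact hdeg
  have hc : (algebraMap (Polynomial ℂ) (RatFunc ℂ)).comp Polynomial.C = RatFunc.C := by
    ext; simp
  have hF' : algebraMap (Polynomial ℂ) (RatFunc ℂ) F = toRat L * RatFunc.X ^ k := by
    rw [← toRat_toLaurent, hF, map_mul, toRat_T, zpow_natCast]
  have hroot : Polynomial.aeval W p = 0 := by
    rw [Polynomial.aeval_def, hp, Polynomial.eval₂_sub, Polynomial.eval₂_mul, Polynomial.eval₂_mul,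
      Polynomial.eval₂_C, Polynomial.eval₂_C, Polynomial.eval₂_map, Polynomial.eval₂_map, hc, hF',
      map_pow, RatFunc.algebraMap_X]
    linear_combination -RatFunc.X ^ k * h
  obtain ⟨y, hy⟩ := IsIntegrallyClosed.isIntegral_iff.1 (isIntegral_leadingCoeff_smul p W hroot)
  rw [hlead, Algebra.smul_def, map_mul, map_pow, RatFunc.algebraMap_X, RatFunc.algebraMap_C] at hy
  refine ⟨C N.leadingCoeff⁻¹ * T (-k) * Polynomial.toLaurent y, ?_⟩
  rw [map_mul, map_mul, toRat_toLaurent, hy, toRat_C, toRat_T, zpow_neg, zpow_natCast, map_inv₀]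
  have h1 : RatFunc.C N.leadingCoeff ≠ 0 := by simpa using hN
  have h2 : (RatFunc.X : RatFunc ℂ) ^ k ≠ 0 := pow_ne_zero _ RatFunc.X_ne_zero
  field_simp

/-- If P has a pole at ∞, W is already a Laurent polynomial. Otherwise P has a finite pole b, and
1/(W - b) is one. -/
theorem exists_mob_toRat {L : LaurentPolynomial ℂ} (hLc : ∀ c, L ≠ C c) {P W : RatFunc ℂ}
    (hW : NonConst W) (h : toRat L = comp P W) :
    ∃ a b c d : ℂ, a * d - b * c ≠ 0 ∧ ∃ w, toRat w = mob a b c d W := by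
  have hrel := mul_denom_eval₂ hW P
  rw [← h] at hrel
  rcases lt_or_ge P.denom.natDegree P.num.natDegree with hlt | hge
  · exact ⟨1, 0, 0, 1, by simp, by rw [mob_id one_ne_zero]; exact exists_toRat_eq hlt hrel⟩
  · have hn : P.denom.natDegree ≠ 0 := by
      intro h0
      have h0' : P.num.natDegree = 0 := by omega
      rw [Polynomial.eq_C_of_natDegree_eq_zero h0, Polynomial.eq_C_of_natDegree_eq_zero h0',
        Polynomial.eval₂_C, Polynomial.eval₂_C] at hrel
      have hd : P.denom.coeff 0 ≠ 0 := by
        intro h1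
        apply P.denom_ne_zero
        rw [Polynomial.eq_C_of_natDegree_eq_zero h0, h1, map_zero]
      refine hLc (P.num.coeff 0 / P.denom.coeff 0) (toRat_injective ?_)
      rw [toRat_C, map_div₀, eq_div_iff (by simpa using hd), hrel]
    obtain ⟨b, hb⟩ := IsAlgClosed.exists_root P.denom (fun h0 => hn (by
      rw [Polynomial.natDegree, h0]; rfl))
    have hNb := num_eval_ne_zero hb
    refine ⟨0, 1, 1, -b, by simp, ?_⟩
    have hWb : W - RatFunc.C b ≠ 0 := sub_ne_zero.2 (hW b)
    have hmob : mob 0 1 1 (-b) W = (W - RatFunc.C b)⁻¹ := by simp [mob, sub_eq_add_neg]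
    rw [hmob]
    let _ : Invertible (W - RatFunc.C b) := invertibleOfNonzero hWb
    set n := P.denom.natDegree
    -- Substituting W = b + 1/y and multiplying by y^n replaces q by the reversal of its Taylor
    -- shift, with y^n-coefficient q(b). This is zero for the denominator and nonzero for the
    -- numerator, so the degrees become strictly ordered.
    have key : ∀ q : Polynomial ℂ, q.natDegree ≤ n →
        ((Polynomial.taylor b q).reflect n).eval₂ RatFunc.C (W - RatFunc.C b)⁻¹ *
          (W - RatFunc.C b) ^ n = q.eval₂ RatFunc.C W := by
      intro q hq
      rw [← invOf_eq_inv, Polynomial.eval₂_reflect_mul_pow _ _ _ _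
        (by rwa [Polynomial.natDegree_taylor]), Polynomial.taylor_apply, Polynomial.eval₂_comp]
      simp
    have hcoeff : ∀ q : Polynomial ℂ, ((Polynomial.taylor b q).reflect n).coeff n = q.eval b := by
      intro q
      rw [Polynomial.coeff_reflect, Polynomial.revAt_le le_rfl, Nat.sub_self,
        Polynomial.taylor_coeff_zero]
    apply exists_toRat_eq (L := L) (N := (Polynomial.taylor b P.num).reflect n)
      (D := (Polynomial.taylor b P.denom).reflect n)
    · refine lt_of_lt_of_le (lt_of_le_of_ne (b := n) ?_ ?_)
        (Polynomial.le_natDegree_of_ne_zero (by rwa [hcoeff]))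
      · refine Polynomial.natDegree_reflect_le.trans ?_
        rw [Polynomial.natDegree_taylor, max_self]
      · intro h0
        have h1 : ((Polynomial.taylor b P.denom).reflect n).leadingCoeff = 0 := by
          rw [Polynomial.leadingCoeff, h0, hcoeff]
          exact hb
        rw [Polynomial.leadingCoeff_eq_zero] at h1
        rw [h1, Polynomial.natDegree_zero] at h0
        exact hn h0.symm
    · rw [← key _ le_rfl, ← key _ hge, ← mul_assoc] at hrel
      exact mul_right_cancel₀ (pow_ne_zero _ hWb) hrel

/-- Clearing denominators in fg = 1 gives polynomials with FG = X^(n+m), and X is prime. -/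
theorem exists_eq_C_mul_T_of_isUnit {f : LaurentPolynomial ℂ} (hf : IsUnit f) :
    ∃ (c : ℂ) (k : ℤ), c ≠ 0 ∧ f = C c * T k := by
  obtain ⟨g, hg⟩ := hf.exists_right_inv
  obtain ⟨n, F, hF⟩ := LaurentPolynomial.exists_T_pow f
  obtain ⟨m, G, hG⟩ := LaurentPolynomial.exists_T_pow g
  have h1 : F * G = Polynomial.X ^ (n + m) := by
    apply Polynomial.toLaurent_injective
    rw [map_mul, hF, hG, Polynomial.toLaurent_X_pow, Nat.cast_add, T_add]
    linear_combination T (n : ℤ) * T (m : ℤ) * hg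
  obtain ⟨i, -, u, hu⟩ := (dvd_prime_pow Polynomial.prime_X _).1 (Dvd.intro _ h1)
  obtain ⟨r, hr, hru⟩ := Polynomial.isUnit_iff.1 u.isUnit
  have hr0 := hr.ne_zero
  refine ⟨r⁻¹, i - n, inv_ne_zero hr0, ?_⟩
  have hX := congrArg Polynomial.toLaurent hu
  rw [map_mul, hF, ← hru, Polynomial.toLaurent_C, Polynomial.toLaurent_X_pow] at hX
  have hTn : (T (n : ℤ) : LaurentPolynomial ℂ) * T (-n) = 1 := by
    rw [← T_add, add_neg_cancel, T_zero]
  have hCr : (C r : LaurentPolynomial ℂ) * C r⁻¹ = 1 := by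
    rw [← map_mul, mul_inv_cancel₀ hr0, map_one]
  rw [T_sub, ← hX]
  linear_combination (-f) * hTn - f * T (n : ℤ) * T (-n : ℤ) * hCr

/-- In L·D(w) = N(w), w - a divides D(w) and N(w) - N(a), hence the nonzero constant N(a). -/
theorem isUnit_of_denom_root {L w : LaurentPolynomial ℂ} {P : RatFunc ℂ}
    (hW : NonConst (toRat w)) (h : toRat L = comp P (toRat w)) {a : ℂ}
    (ha : P.denom.eval a = 0) : IsUnit (w - C a) := by
  have hrel := mul_denom_eval₂ hW P
  have hev : ∀ q : Polynomial ℂ, q.eval₂ RatFunc.C (toRat w) = toRat (q.eval₂ C w) := by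
    intro q
    rw [Polynomial.hom_eval₂]
    congr 1
    ext; simp
  rw [← h, hev, hev, ← map_mul] at hrel
  replace hrel := toRat_injective hrel
  obtain ⟨D1, hD1⟩ := Polynomial.dvd_iff_isRoot.2 ha
  obtain ⟨N1, hN1⟩ := Polynomial.X_sub_C_dvd_sub_C_eval (a := a) (p := P.num)
  have e1 := congrArg (Polynomial.eval₂ C w) hD1
  have e2 := congrArg (Polynomial.eval₂ C w) hN1
  simp only [Polynomial.eval₂_mul, Polynomial.eval₂_sub, Polynomial.eval₂_X,
    Polynomial.eval₂_C] at e1 e2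
  have hu : IsUnit (C (P.num.eval a) : LaurentPolynomial ℂ) :=
    (IsUnit.mk0 _ (num_eval_ne_zero ha)).map C
  refine isUnit_of_dvd_unit ⟨L * D1.eval₂ C w - N1.eval₂ C w, ?_⟩ hu
  linear_combination L * e1 - hrel - e2

/-! ### Invariance -/

theorem exists_mob_invariant_of_mob {W : RatFunc ℂ} (hW : NonConst W) {a b c d : ℂ}
    (h : a * d - b * c ≠ 0)
    (hinv : ∃ a' b' c' d' : ℂ, a' * d' - b' * c' ≠ 0 ∧
      sigma (mob a' b' c' d' (mob a b c d W)) = mob a' b' c' d' (mob a b c d W)) :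
    ∃ a' b' c' d' : ℂ, a' * d' - b' * c' ≠ 0 ∧ sigma (mob a' b' c' d' W) = mob a' b' c' d' W := by
  obtain ⟨a', b', c', d', h', hinv⟩ := hinv
  rw [mob_mob hW h] at hinv
  refine ⟨_, _, _, _, ?_, hinv⟩
  convert mul_ne_zero h' h using 1
  ring

/-- The Cayley transform carries the unit circle to the real line: at z = e^{iθ} the value is
-cot(kθ/2). -/
theorem sigma_cayley {k : ℤ} (hk : NonConst (RatFunc.X ^ k)) :
    sigma (mob Complex.I Complex.I (-1) 1 (RatFunc.X ^ k)) =
      mob Complex.I Complex.I (-1) 1 (RatFunc.X ^ k) := by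
  have h0 : (RatFunc.X : RatFunc ℂ) ^ k ≠ 0 := zpow_ne_zero _ RatFunc.X_ne_zero
  have h1 : (RatFunc.X : RatFunc ℂ) ^ k - 1 ≠ 0 := sub_ne_zero.2 (by simpa using hk 1)
  have h2 : 1 - (RatFunc.X : RatFunc ℂ) ^ k ≠ 0 := sub_ne_zero.2 (by simpa using (hk 1).symm)
  rw [map_mob sigma (starRingEnd ℂ) sigma_C, map_zpow₀, sigma_X, inv_zpow]
  simp only [mob, Complex.conj_I, map_neg, map_one]
  rw [div_eq_div_iff]
  · field_simp
    ring
  · rw [neg_one_mul, neg_add_eq_sub, sub_ne_zero]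
    intro h
    exact h1 (sub_eq_zero.2 (inv_eq_one.1 h.symm))
  · rwa [neg_one_mul, neg_add_eq_sub]

theorem exists_mob_invariant {L : LaurentPolynomial ℂ} (hL : starL L = L) (hLc : ∀ c, L ≠ C c)
    {P W : RatFunc ℂ} (hW : NonConst W) (h : toRat L = comp P W) :
    ∃ a b c d : ℂ, a * d - b * c ≠ 0 ∧ sigma (mob a b c d W) = mob a b c d W := by
  obtain ⟨a, b, c, d, hdet, w, hw⟩ := exists_mob_toRat hLc hW h
  apply exists_mob_invariant_of_mob hW hdet
  have hdet' : d * a - -b * -c ≠ 0 := by rwa [neg_mul_neg, mul_comm d]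
  have hw' := hW.mob hdet
  replace h : toRat L = comp (comp P (mob d (-b) (-c) a RatFunc.X)) (mob a b c d W) := by
    rw [comp_assoc (nonConst_X.mob hdet') hw', comp_mob hw', comp_X, mob_inv hW hdet, h]
  rw [← hw] at h hw' ⊢
  generalize comp P (mob d (-b) (-c) a RatFunc.X) = P' at h
  by_cases hD : P'.denom.natDegree = 0
  · have hD1 : P'.denom = 1 := P'.monic_denom.natDegree_eq_zero.1 hD
    have hrel := mul_denom_eval₂ hw' P'
    rw [hD1, Polynomial.eval₂_one, mul_one, ← h] at hrel
    obtain ⟨a', b', ha', hinv⟩ := exists_affine_of_polynomial hL hLc hrel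
    exact ⟨a', b', 0, 1, by simpa using ha', hinv⟩
  · obtain ⟨r, hr⟩ := IsAlgClosed.exists_root P'.denom (fun h0 => hD (by
      rw [Polynomial.natDegree, h0]; rfl))
    obtain ⟨e, k, he, hwk⟩ := exists_eq_C_mul_T_of_isUnit (isUnit_of_denom_root hw' h hr)
    have hdet2 : (1 : ℂ) * e - -r * 0 ≠ 0 := by simpa using he
    apply exists_mob_invariant_of_mob hw' hdet2
    have hX : mob 1 (-r) 0 e (toRat w) = RatFunc.X ^ k := by
      have h1 := congrArg toRat hwk
      rw [map_sub, map_mul, toRat_C, toRat_C, toRat_T] at h1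
      have h2 : RatFunc.C e ≠ 0 := by simpa using he
      rw [mob, map_zero, zero_mul, zero_add, map_one, one_mul, map_neg, ← sub_eq_add_neg, h1,
        mul_div_cancel_left₀ _ h2]
    have hXk : NonConst (RatFunc.X ^ k) := hX ▸ hw'.mob hdet2
    refine ⟨_, _, _, _, ?_, hX ▸ sigma_cayley hXk⟩
    rw [mul_one, mul_neg_one, sub_neg_eq_add, ← two_mul]
    exact mul_ne_zero two_ne_zero Complex.I_ne_zero

/-! ### Real decompositions and transfer to `RtField` -/

theorem exists_real_decomposition {L : LaurentPolynomial ℂ} (hL : L ∈ LR) (hLc : ∀ c, L ≠ C c)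
    {P W : RatFunc ℂ} (h : toRat L = comp P W) :
    ∃ v v' : RatFunc ℂ, ratDegree v = 1 ∧ ratDegree v' = 1 ∧ IsCompInverse v v' ∧
      (∃ Q : RatFunc ℝ, ofRealRat Q = comp P v') ∧ sigma (comp v W) = comp v W ∧
      NonConst (comp v W) ∧ comp (comp P v') (comp v W) = toRat L := by
  have hW : NonConst W := by
    rintro c rfl
    obtain ⟨d, hd⟩ := comp_C P c
    rw [hd, ← toRat_C] at h
    exact hLc _ (toRat_injective h)
  have hstar := starL_of_mem_LR hL
  obtain ⟨a, b, c, d, hdet, hinv⟩ := exists_mob_invariant hstar hLc hW h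
  have hdet' : d * a - -b * -c ≠ 0 := by rwa [neg_mul_neg, mul_comm d]
  have hv' := nonConst_X.mob hdet'
  have hvW : comp (mob a b c d RatFunc.X) W = mob a b c d W := by rw [comp_mob hW, comp_X]
  have hW1 := hW.mob hdet
  have hcomp : comp (comp P (mob d (-b) (-c) a RatFunc.X)) (mob a b c d W) = toRat L := by
    rw [comp_assoc hv' hW1, comp_mob hW1, comp_X, mob_inv hW hdet, h]
  refine ⟨mob a b c d RatFunc.X, mob d (-b) (-c) a RatFunc.X, ratDegree_mob hdet,
    ratDegree_mob hdet', isCompInverse_mob hdet, ?_, ?_, ?_, ?_⟩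
  · apply exists_ofRealRat_of_conjRat_eq
    -- Both P∘v⁻¹ and its conjugate give L after composition with v∘W, since `sigma` fixes L and
    -- v∘W.
    apply (compHom _ hW1).injective
    rw [← comp_eq_compHom, ← comp_eq_compHom, hcomp]
    conv_lhs => rw [← hinv]
    rw [← sigma_comp hW1, hcomp, sigma_toRat, hstar]
  · rw [hvW, hinv]
  · rwa [hvW]
  · rw [hvW, hcomp]

/-- This brings the identity in ℂ(z) back to `RtField` by injectivity of `phiField`. -/
theorem phiField_eval (Q : RatFunc ℝ) (w : RtField) (hw : NonConst (phiField w)) :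
    phiField (RatFunc.eval (algebraMap ℝ RtField) w Q) = comp (ofRealRat Q) (phiField w) := by
  have hc : phiField.comp (algebraMap ℝ RtField) = RatFunc.C.comp (algebraMap ℝ ℂ) := by
    ext1 r
    rw [RingHom.comp_apply, IsScalarTower.algebraMap_apply ℝ Rt RtField, phiField_algebraMap,
      AlgHom.commutes]
    exact toRat_C _
  conv_rhs => rw [← RatFunc.num_div_denom Q]
  rw [comp_eq_compHom hw, ofRealRat, map_div₀, map_div₀, mapCoeff_algebraMap, mapCoeff_algebraMap,
    compHom_algebraMap, compHom_algebraMap, Polynomial.eval₂_map, Polynomial.eval₂_map, RatFunc.eval,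
    map_div₀, Polynomial.hom_eval₂, Polynomial.hom_eval₂, hc]

/-- A constant fixed by `starL` is real. -/
theorem phi_ne_C {p : Rt} (hp : ∀ c : ℝ, p ≠ algebraMap ℝ Rt c) (c : ℂ) : phi p ≠ C c := by
  intro h
  have h1 := starL_of_mem_LR (L := phi p) ⟨p, rfl⟩
  rw [h, starL_C] at h1
  have h2 := toRat_injective.eq_iff.2 h1
  rw [toRat_C, toRat_C] at h2
  have hc := Complex.conj_eq_iff_re.1 (RatFunc.C_injective h2)
  apply hp c.re
  apply phi_injective
  rw [h, AlgHom.commutes, ← hc]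
  rfl

end TrigDecomp

theorem mainTheorem2 :
    (∀ L ∈ TrigDecomp.LR, (∀ c : ℂ, L ≠ LaurentPolynomial.C c) →
      ∀ P W : RatFunc ℂ, TrigDecomp.toRat L = TrigDecomp.comp P W →
        ∃ v v' : RatFunc ℂ, TrigDecomp.ratDegree v = 1 ∧ TrigDecomp.IsCompInverse v v' ∧
          (∃ Q : RatFunc ℝ, TrigDecomp.ofRealRat Q = TrigDecomp.comp P v') ∧
          TrigDecomp.comp v W ∈ TrigDecomp.LRField) ∧
    (∀ p : TrigDecomp.Rt, (∀ c : ℝ, p ≠ algebraMap ℝ TrigDecomp.Rt c) →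
      ∀ P W : RatFunc ℂ, TrigDecomp.toRat (TrigDecomp.phi p) = TrigDecomp.comp P W →
        ∃ P' W' : RatFunc ℂ, TrigDecomp.DecompEquiv P W P' W' ∧
          ∃ (Q : RatFunc ℝ) (w : TrigDecomp.RtField),
            P' = TrigDecomp.ofRealRat Q ∧ W' = TrigDecomp.phiField w ∧
            algebraMap TrigDecomp.Rt TrigDecomp.RtField p =
              RatFunc.eval (algebraMap ℝ TrigDecomp.RtField) w Q) := by
  constructor
  · intro L hL hLc P W h
    obtain ⟨v, v', hv, -, hinv, hQ, hs, -, -⟩ := TrigDecomp.exists_real_decomposition hL hLc h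
    exact ⟨v, v', hv, hinv, hQ, TrigDecomp.mem_LRField.2 hs⟩
  · intro p hp P W h
    obtain ⟨v, v', -, hv', hinv, ⟨Q, hQ⟩, hs, hnc, hc⟩ :=
      TrigDecomp.exists_real_decomposition ⟨p, rfl⟩ (TrigDecomp.phi_ne_C hp) h
    obtain ⟨w, hw⟩ := TrigDecomp.exists_phiField_of_sigma hs
    -- The equivalence uses μ = v⁻¹, so v and its inverse exchange roles.
    refine ⟨_, _, ⟨v', v, hv', ⟨hinv.2, hinv.1⟩, rfl, rfl⟩, Q, w, hQ.symm, hw.symm, ?_⟩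
    apply TrigDecomp.phiField.injective
    rw [TrigDecomp.phiField_eval Q w (hw ▸ hnc), TrigDecomp.phiField_algebraMap, hw, hQ, hc]
    rfl
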